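/- **Setting.** All vector spaces are real; a Fréchet space is a Hausdorff, locally convex, metrizable and complete topological vector space. Let $X$ and $Z$ be Fréchet spaces and let $C\subseteq Z$ be a nonempty convex cone, i.e. $tC\subseteq C$ for all $t\ge 0$ and $C+C\subseteq C$ (so $0\in C$). Write $z_1\leq_C z_2$ if $z_2-z_1\in C$. Let $Z^\bullet=Z\cup\{\infty_C\}$, where $a\leq_C\infty_C$ for all $a\in Z^\bullet$, $\infty_C\not\leq_C z$ for $z\in Z$, $a+\infty_C=\infty_C+a=\infty_C$ for all $a\in Z^\bullet$, and $t\,\infty_C=\infty_C$ for all $t\ge 0$. For $f:X\to\overline{\mathbb R}=\mathbb R\cup\{\pm\infty\}$ put $\operatorname{dom} f=\{x: f(x)<+\infty\}$; $f$ is *proper* if $\operatorname{dom} f\ne\emptyset$ and $f>-\infty$ everywhere. Convexity of $f$ means $f(tx+(1-t)y)\le tf(x)+(1-t)f(y)$ for all $x,y\in X$, $t\in[0,1]$, with the conventions $(+\infty)+(-\infty)=+\infty$, $0\cdot(+\infty)=+\infty$, $0\cdot(-\infty)=0$. For $g:X\to Z^\bullet$ put $\operatorname{dom} g=\{x: g(x)\in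 Z\}$; $g$ is *proper* if $\operatorname{dom} g\neq\emptyset$, *$C$-convex* if $g(tx+(1-t)y)\leq_C tg(x)+(1-t)g(y)$ for all $x,y\in X$, $t\in[0,1]$, and *$C$-epi closed* if $\{(x,z)\in X\times Z: g(x)\leq_C z\}$ is closed in $X\times Z$. For a convex subset $U$ of a Hausdorff locally convex space $E$ let $\operatorname{cone}(U)=\bigcup_{t\ge0}tU$ and $$\operatorname{core}(U)=\{x\in U:\operatorname{cone}(U-x)=E\},\qquad \operatorname{qi}(U)=\{x\in U:\operatorname{cl}(\operatorname{cone}(U-x))=E\},$$ $$\operatorname{qri}(U)=\{x\in U:\operatorname{cl}(\operatorname{cone}(U-x))\text{ is a linear subspace of }E\}.$$ **Proposition.** Let $S\subseteq X$ be nonempty, convex and closed, let $f:X\to\overline{\mathbb R}$ be proper, convex and lower semicontinuous, and let $g:X\to Z^\bullet$ be proper, $C$-convex and $C$-epi closed. Assume that $\operatorname{dom} f\cap S\cap g^{-1}(-C)\neq\emptyset$ and that the optimal value $$v=\inf\{f(x): x\in S,\ g(x)\in -C\}$$ is a real number. Put $$M=g(\operatorname{dom} f\cap S\cap\operatorname{dom}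 g)+C,$$ $$\mathcal E_v=\{(g(x)+z,\ f(x)-v+\varepsilon): x\in\operatorname{dom} f\cap S\cap\operatorname{dom} g,\ z\in C,\ \varepsilon\ge 0\}\subseteq Z\times\mathbb R,$$ and consider the conditions - $(RC_1^L)$: there is $x'\in\operatorname{dom} f\cap S$ with $g(x')\in-\operatorname{int}(C)$; - $(RC_2^L)$: $X$ and $Z$ are Fréchet spaces, $S$ is closed, $f$ is lower semicontinuous, $g$ is $C$-epi closed and $0\in\operatorname{int}(M)$; - $(RC_3^L)$: $X$ and $Z$ are Fréchet spaces, $S$ is closed, $f$ is lower semicontinuous, $g$ is $C$-epi closed and $0\in\operatorname{core}(M)$; - $(RC_6^L)$: $0\in\operatorname{qi}(M)$ and $(0,0)\notin\operatorname{qri}\big[\operatorname{co}(\mathcal E_v\cup\{(0,0)\})\big]$; - $(RC_7^L)$: $0\in\operatorname{qi}(M-M)$, $0\in\operatorname{qri}(M)$ and $(0,0)\notin\operatorname{qri}\big[\operatorname{co}(\mathcal E_v\cup\{(0,0)\})\big]$. Then $$(RC_1^L)\Rightarrow(RC_2^L)\Leftrightarrow(RC_3^L)\Rightarrow(RC_6^L)\Leftrightarrow(RC_7^L).$$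 -/

import Mathlib

open Set Topology
open scoped Pointwise

namespace LagrangeQri

/-- A real Fréchet space: a Hausdorff locally convex topological vector space which is first
countable (equivalently, metrizable) and complete for its canonical uniformity. -/
class FrechetSpace (E : Type*) [AddCommGroup E] [Module ℝ E] [UniformSpace E] : Prop extends
    IsUniformAddGroup E, ContinuousSMul ℝ E, LocallyConvexSpace ℝ E, T2Space E,
    FirstCountableTopology E, CompleteSpace E

section Interiors

variable {E : Type*} [AddCommGroup E] [Module ℝ E]

/-- The conic hull `⋃ t ≥ 0, t • U`. -/
def conicHull (U : Set E) : Set E := ⋃ t ∈ Ici (0 : ℝ), t • U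

/-- The algebraic interior of `U`. -/
def core (U : Set E) : Set E := {x | x ∈ U ∧ conicHull (U - {x}) = univ}

/-- The quasi interior of `U`. -/
def qi [TopologicalSpace E] (U : Set E) : Set E :=
  {x | x ∈ U ∧ closure (conicHull (U - {x})) = univ}

/-- The quasi-relative interior of `U`. -/
def qri [TopologicalSpace E] (U : Set E) : Set E :=
  {x | x ∈ U ∧ ∃ L : Submodule ℝ E, closure (conicHull (U - {x})) = (L : Set E)}

end Interiors

section ExtendedReal

variable {X : Type*}

/-- Addition of extended reals with the convention `(+∞) + (-∞) = +∞`. -/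
noncomputable def convAdd (a b : EReal) : EReal :=
  open Classical in if a = ⊤ ∨ b = ⊤ then ⊤ else a + b

/-- Product of a nonnegative real and an extended real, with the conventions
`0 · (+∞) = +∞` and `0 · (-∞) = 0`. -/
noncomputable def convMul (t : ℝ) (a : EReal) : EReal :=
  open Classical in if a = ⊤ then ⊤ else (t : EReal) * a

/-- Convexity of an extended-real-valued function. -/
def IsConvex [AddCommGroup X] [Module ℝ X] (f : X → EReal) : Prop :=
  ∀ x y : X, ∀ t ∈ Icc (0 : ℝ) 1,
    f (t • x + (1 - t) • y) ≤ convAdd (convMul t (f x)) (convMul (1 - t) (f y))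

/-- The domain of an extended-real-valued function. -/
def dom (f : X → EReal) : Set X := {x | f x < ⊤}

/-- Properness of an extended-real-valued function. -/
def IsProper (f : X → EReal) : Prop := (dom f).Nonempty ∧ ∀ x, ⊥ < f x

end ExtendedReal

/-! Vector functions take values in `WithTop Z`, that is `Z` with a largest element `⊤` added;
the addition of `WithTop Z` satisfies `y + ⊤ = ⊤ + y = ⊤`. -/
section VectorFunctions

variable {X Z : Type*} [AddCommGroup Z] [Module ℝ Z]

/-- Multiplication by a nonnegative scalar, with `t · ⊤ = ⊤` (also for `t = 0`). -/
def scale (t : ℝ) (a : WithTop Z) : WithTop Z := a.map (fun z => t • z)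

/-- The ordering induced by `C`, with `⊤` as largest element. -/
def LeC (C : PointedCone ℝ Z) (a b : WithTop Z) : Prop :=
  b = ⊤ ∨ ∃ y₁ y₂ : Z, a = y₁ ∧ b = y₂ ∧ y₂ - y₁ ∈ C

/-- The domain of a vector function. -/
def vdom (g : X → WithTop Z) : Set X := {x | ∃ z : Z, g x = z}

/-- The `C`-epigraph of a vector function. -/
def epiC (C : PointedCone ℝ Z) (g : X → WithTop Z) : Set (X × Z) :=
  {p | LeC C (g p.1) (p.2 : WithTop Z)}

/-- `C`-convexity of a vector function. -/
def IsCConvex [AddCommGroup X] [Module ℝ X] (C : PointedCone ℝ Z) (g : X → WithTop Z) : Prop :=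
  ∀ x y : X, ∀ t ∈ Icc (0 : ℝ) 1,
    LeC C (g (t • x + (1 - t) • y)) (scale t (g x) + scale (1 - t) (g y))

/-- `C`-epi closedness of a vector function. -/
def IsCEpiClosed [TopologicalSpace X] [TopologicalSpace Z] (C : PointedCone ℝ Z)
    (g : X → WithTop Z) : Prop :=
  IsClosed (epiC C g)

/-- The set `g(A) ∩ Z`, which is `g(A)` when `A` is contained in the domain of `g`. -/
def vimage (g : X → WithTop Z) (A : Set X) : Set Z := {z | ∃ x ∈ A, g x = z}

/-- The preimage of `D ⊆ Z` under `g`. -/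
def vpreimage (g : X → WithTop Z) (D : Set Z) : Set X := {x | ∃ z ∈ D, g x = z}

end VectorFunctions

section Problem

variable {X Z : Type*} [AddCommGroup Z] [Module ℝ Z]

/-- The feasible set `T = {x ∈ S : g(x) ∈ -C}`. -/
def feasible (C : PointedCone ℝ Z) (S : Set X) (g : X → WithTop Z) : Set X :=
  S ∩ vpreimage g (-(C : Set Z))

/-- The optimal value of minimizing `f` over the feasible set. -/
noncomputable def primalValue (C : PointedCone ℝ Z) (S : Set X) (f : X → EReal)
    (g : X → WithTop Z) : EReal :=
  ⨅ x ∈ feasible C S g, f x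

/-- The set `g(dom f ∩ S ∩ dom g) + C`. -/
def constraintRange (C : PointedCone ℝ Z) (S : Set X) (f : X → EReal) (g : X → WithTop Z) :
    Set Z :=
  vimage g (dom f ∩ S ∩ vdom g) + (C : Set Z)

/-- The set of the pairs `(g(x) + z, f(x) - v + ε)` with `x ∈ dom f ∩ S ∩ dom g`, `z ∈ C`
and `ε ≥ 0`. -/
def conicExtension (C : PointedCone ℝ Z) (S : Set X) (f : X → EReal) (g : X → WithTop Z)
    (v : ℝ) : Set (Z × ℝ) :=
  {p | ∃ x ∈ dom f ∩ S ∩ vdom g, ∃ y : Z, g x = y ∧ ∃ z ∈ C, ∃ ε : ℝ, 0 ≤ ε ∧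
    p.1 = y + z ∧ (p.2 : EReal) = f x - (v : EReal) + (ε : EReal)}

/-- The Slater condition. -/
def RC1 [TopologicalSpace Z] (C : PointedCone ℝ Z) (S : Set X) (f : X → EReal)
    (g : X → WithTop Z) : Prop :=
  ∃ x ∈ dom f ∩ S, ∃ z ∈ -interior (C : Set Z), g x = z

/-- The condition expressed by means of the interior. -/
def RC2 [AddCommGroup X] [Module ℝ X] [UniformSpace X] [UniformSpace Z] (C : PointedCone ℝ Z)
    (S : Set X) (f : X → EReal) (g : X → WithTop Z) : Prop :=
  FrechetSpace X ∧ FrechetSpace Z ∧ IsClosed S ∧ LowerSemicontinuous f ∧ IsCEpiClosed C g ∧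
    (0 : Z) ∈ interior (constraintRange C S f g)

/-- The condition expressed by means of the algebraic interior. -/
def RC3 [AddCommGroup X] [Module ℝ X] [UniformSpace X] [UniformSpace Z] (C : PointedCone ℝ Z)
    (S : Set X) (f : X → EReal) (g : X → WithTop Z) : Prop :=
  FrechetSpace X ∧ FrechetSpace Z ∧ IsClosed S ∧ LowerSemicontinuous f ∧ IsCEpiClosed C g ∧
    (0 : Z) ∈ core (constraintRange C S f g)

/-- The condition expressed by means of the quasi interior; `v` is the optimal value. -/
def RC6 [TopologicalSpace Z] (C : PointedCone ℝ Z) (S : Set X) (f : X → EReal)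
    (g : X → WithTop Z) (v : ℝ) : Prop :=
  (0 : Z) ∈ qi (constraintRange C S f g) ∧
    ((0, 0) : Z × ℝ) ∉ qri (convexHull ℝ (conicExtension C S f g v ∪ {(0, 0)}))

/-- The condition expressed by means of the quasi-relative interior; `v` is the optimal value. -/
def RC7 [TopologicalSpace Z] (C : PointedCone ℝ Z) (S : Set X) (f : X → EReal)
    (g : X → WithTop Z) (v : ℝ) : Prop :=
  (0 : Z) ∈ qi (constraintRange C S f g - constraintRange C S f g) ∧
    (0 : Z) ∈ qri (constraintRange C S f g) ∧
    ((0, 0) : Z × ℝ) ∉ qri (convexHull ℝ (conicExtension C S f g v ∪ {(0, 0)}))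

end Problem

end LagrangeQri

open LagrangeQri

/-! ### Baire category and the Robinson–Ursescu theorem. -/

open Filter

/-! `conicExtension` is the projection to `Z × ℝ` of the closed convex set `lagrangeGraph`, and
`constraintRange` is its further projection to `Z`. If `0` is in the core of the latter and `(0,
r₀)` lies in `conicExtension`, this set is absorbing about `(0, r₀ + 1)`, so Robinson–Ursescu
(`Convex.snd_image_mem_nhds`) makes it a neighbourhood of that point. The slice at height `r₀ + 1`
turns core into interior.

If `(0, 0)` were in the qri, the closed cone would be a subspace with interior points, hence
everything; a dense convex cone with interior points is itself everything, so it contains `(0, -1)`.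
That yields a feasible point with value below `v`. The link between `RC6` and `RC7` is pure cone
algebra (`zero_mem_qi_iff`). -/

theorem Convex.closure_mem_nhds_zero_of_absorbs {Z : Type*} [AddCommGroup Z] [Module ℝ Z]
    [TopologicalSpace Z] [IsTopologicalAddGroup Z] [ContinuousSMul ℝ Z] [BaireSpace Z]
    {A : Set Z} (hA : Convex ℝ A) (habs : ∀ z : Z, ∃ t : ℝ, 0 < t ∧ t • z ∈ A) :
    closure A ∈ 𝓝 (0 : Z) := by
  have h0 : (0 : Z) ∈ A := by
    obtain ⟨t, -, ht⟩ := habs 0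
    simpa using ht
  have hcover : ⋃ n : ℕ, ((n : ℝ) + 1) • closure A = univ := by
    refine eq_univ_of_forall fun z => ?_
    obtain ⟨t, ht, hz⟩ := habs z
    obtain ⟨n, hn⟩ := exists_nat_ge t⁻¹
    have hn1 : (0 : ℝ) < (n : ℝ) + 1 := by positivity
    refine mem_iUnion.2 ⟨n, (mem_smul_set_iff_inv_smul_mem₀ hn1.ne' _ _).2 (subset_closure ?_)⟩
    have h1 : ((n : ℝ) + 1)⁻¹ ≤ t := by
      rw [inv_le_comm₀ hn1 ht]; linarith
    have := hA.smul_mem_of_zero_mem h0 hz (t := ((n : ℝ) + 1)⁻¹ / t)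
      ⟨by positivity, (div_le_one ht).2 h1⟩
    rwa [smul_smul, div_mul_cancel₀ _ ht.ne'] at this
  obtain ⟨n, z, hz⟩ := nonempty_interior_of_iUnion_of_closed
    (fun n : ℕ => isClosed_closure.smul_of_ne_zero (by positivity : (n : ℝ) + 1 ≠ 0)) hcover
  have hn1 : ((n : ℝ) + 1) ≠ 0 := by positivity
  rw [interior_smul₀ hn1, mem_smul_set_iff_inv_smul_mem₀ hn1] at hz
  generalize ((n : ℝ) + 1)⁻¹ • z = w at hz
  -- Baire gives an interior point `w`; averaging it with `-(t • w)` moves it to `0`.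
  obtain ⟨t, ht, htw⟩ := habs (-w)
  have := hA.closure.combo_interior_closure_mem_interior hz (subset_closure (subset_closure htw))
    (a := t / (1 + t)) (b := 1 / (1 + t)) (by positivity) (by positivity) (by field_simp; ring)
  rw [smul_neg, smul_neg, smul_smul, div_mul_eq_mul_div, one_mul, add_neg_cancel] at this
  exact mem_interior_iff_mem_nhds.1 this

/-- Uniformity in `s` replaces translation invariance of the metric, which is not assumed. -/
theorem exists_convex_nhds_zero_dist_add_le {Y : Type*} [AddCommGroup Y] [Module ℝ Y]
    [PseudoMetricSpace Y] [IsUniformAddGroup Y] [ContinuousSMul ℝ Y] [LocallyConvexSpace ℝ Y]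
    {ε : ℝ} (hε : 0 < ε) :
    ∃ U ∈ 𝓝 (0 : Y), Convex ℝ U ∧ ∀ u ∈ U, ∀ s : Y, dist s (s + u) ≤ ε := by
  have h := Metric.dist_mem_uniformity (α := Y) hε
  rw [uniformity_eq_comap_nhds_zero Y, mem_comap] at h
  obtain ⟨V, hV, hVε⟩ := h
  obtain ⟨U, ⟨hU, hUc⟩, hUV⟩ :=
    ((LocallyConvexSpace.convex_basis_zero ℝ Y).mem_iff).1 hV
  refine ⟨U, hU, hUc, fun u hu s => ?_⟩
  have : (s, s + u) ∈ {p : Y × Y | dist p.1 p.2 < ε} := hVε (by simpa using hUV hu)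
  exact le_of_lt this

/-- The Robinson–Ursescu theorem for a closed convex graph containing the origin. -/
theorem Convex.snd_image_mem_nhds_zero_of_zero_mem {Y Z : Type*} [AddCommGroup Y] [Module ℝ Y]
    [UniformSpace Y] [IsUniformAddGroup Y] [ContinuousSMul ℝ Y] [LocallyConvexSpace ℝ Y]
    [FirstCountableTopology Y] [CompleteSpace Y]
    [AddCommGroup Z] [Module ℝ Z] [TopologicalSpace Z] [IsTopologicalAddGroup Z]
    [ContinuousSMul ℝ Z] [FirstCountableTopology Z] [BaireSpace Z]
    {W : Set (Y × Z)} (hW : Convex ℝ W) (hWc : IsClosed W) (h0 : (0 : Y × Z) ∈ W)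
    (habs : ∀ z : Z, ∃ t : ℝ, 0 < t ∧ t • z ∈ Prod.snd '' W) :
    Prod.snd '' W ∈ 𝓝 (0 : Z) := by
  have : (uniformity Y).IsCountablyGenerated :=
    IsUniformAddGroup.uniformity_countably_generated
  let _ : PseudoMetricSpace Y := UniformSpace.pseudoMetricSpace Y
  -- The radii are those required by `cauchySeq_of_le_geometric_two` with constant `1`.
  choose U hU hUc hUd using fun n : ℕ =>
    exists_convex_nhds_zero_dist_add_le (Y := Y) (ε := 1 / 2 / 2 ^ n) (by positivity)
  obtain ⟨V, hV⟩ := (𝓝 (0 : Z)).exists_antitone_basis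
  let R : ℕ → Set Z := fun n => Prod.snd '' (W ∩ Prod.fst ⁻¹' U n)
  have hRc (n : ℕ) : Convex ℝ (R n) :=
    (hW.inter ((hUc n).linear_preimage (LinearMap.fst ℝ Y Z))).linear_image (LinearMap.snd ℝ Y Z)
  have hRabs (n : ℕ) (z : Z) : ∃ t : ℝ, 0 < t ∧ t • z ∈ R n := by
    obtain ⟨t, ht, ⟨y, z'⟩, hyz, rfl : z' = t • z⟩ := habs z
    have hlim : Tendsto (fun s : ℝ => s • y) (𝓝[>] 0) (𝓝 0) := by
      have : Tendsto (fun s : ℝ => s • y) (𝓝 0) (𝓝 ((0 : ℝ) • y)) :=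
        tendsto_id.smul tendsto_const_nhds
      rw [zero_smul] at this
      exact this.mono_left nhdsWithin_le_nhds
    obtain ⟨s, hsU, hs0, hs1⟩ :=
      ((hlim.eventually (hU n)).and (Ioo_mem_nhdsGT (zero_lt_one' ℝ))).exists
    exact ⟨s * t, by positivity, (s • y, (s * t) • z),
      ⟨by simpa [smul_smul] using hW.smul_mem_of_zero_mem h0 hyz ⟨hs0.le, hs1.le⟩, hsU⟩, rfl⟩
  have hRn (n : ℕ) : (fun w : Z => (2 : ℝ) • w) ⁻¹' closure (R n) ∈ 𝓝 (0 : Z) := by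
    apply (continuous_const_smul (2 : ℝ)).continuousAt.preimage_mem_nhds
    rw [smul_zero]
    exact (hRc n).closure_mem_nhds_zero_of_absorbs (hRabs n)
  refine mem_of_superset (hRn 0) fun z₀ hz₀ => ?_
  -- Approximate `2w` by the second coordinate of a point of `W` whose first coordinate is small;
  -- the error is the next `w`, again admissible and tending to `0`.
  have hstep (n : ℕ) (w : Z) (hw : (2 : ℝ) • w ∈ closure (R n)) :
      ∃ p ∈ W, p.1 ∈ U n ∧ (2 : ℝ) • ((2 : ℝ) • w - p.2) ∈ closure (R (n + 1)) ∧
        (2 : ℝ) • w - p.2 ∈ V n := by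
    have hnhds : (fun z => (2 : ℝ) • w - z) ⁻¹'
        ((fun w : Z => (2 : ℝ) • w) ⁻¹' closure (R (n + 1)) ∩ V n) ∈ 𝓝 ((2 : ℝ) • w) := by
      apply (continuous_const.sub continuous_id).continuousAt.preimage_mem_nhds
      simpa using inter_mem (hRn (n + 1)) (hV.mem n)
    obtain ⟨_, ⟨h1, h2⟩, p, ⟨hpW, hpU⟩, rfl⟩ := mem_closure_iff_nhds.1 hw _ hnhds
    exact ⟨p, hpW, hpU, h1, h2⟩
  choose p hpW hpU hpR hpV using hstep
  let q : ∀ n : ℕ, {w : Z // (2 : ℝ) • w ∈ closure (R n)} := fun n =>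
    Nat.rec ⟨z₀, hz₀⟩ (fun n w => ⟨(2 : ℝ) • w.1 - (p n w.1 w.2).2, hpR n w.1 w.2⟩) n
  let y : ℕ → Y := fun n => (p n (q n).1 (q n).2).1
  have hq (n : ℕ) : (q (n + 1)).1 = (2 : ℝ) • (q n).1 - (p n (q n).1 (q n).2).2 := rfl
  let s : ℕ → Y := fun n => ∑ k ∈ Finset.range n, (1 / 2 : ℝ) ^ (k + 1) • y k
  have hs (n : ℕ) : s (n + 1) = s n + (1 / 2 : ℝ) ^ (n + 1) • y n := Finset.sum_range_succ _ _
  -- The pair is the sum of the chosen points with weights `1/2, …, 1/2 ^ n`; `r` carries the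
  -- missing weight `1/2 ^ n`. The induction replaces `r` by the midpoint of the next chosen point
  -- and `r`.
  have hsW (n : ℕ) : ∀ r ∈ W, (s n, z₀ - (1 / 2 : ℝ) ^ n • (q n).1) + (1 / 2 : ℝ) ^ n • r ∈ W := by
    induction n with
    | zero =>
      intro r hr
      have : (q 0).1 = z₀ := rfl
      simpa [s, this, Prod.mk_zero_zero] using hr
    | succ n ih =>
      intro r hr
      have := ih _ (hW (hpW n (q n).1 (q n).2) hr (a := 1 / 2) (b := 1 / 2)
        (by norm_num) (by norm_num) (by norm_num))
      convert this using 1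
      ext1
      · simp only [hs, Prod.fst_add, Prod.smul_fst, y, pow_succ]
        module
      · simp only [hq, Prod.snd_add, Prod.smul_snd, pow_succ]
        module
  have hcauchy : CauchySeq s := by
    refine cauchySeq_of_le_geometric_two (C := 1) fun n => ?_
    rw [hs]
    exact hUd n _ ((hUc n).smul_mem_of_zero_mem (mem_of_mem_nhds (hU n)) (hpU n _ _)
      ⟨by positivity, pow_le_one₀ (by norm_num) (by norm_num)⟩) _
  obtain ⟨a, ha⟩ := cauchySeq_tendsto_of_complete hcauchy
  have hq0 : Tendsto (fun n => (q n).1) atTop (𝓝 0) := by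
    rw [← tendsto_add_atTop_iff_nat 1]
    exact hV.tendsto fun n => hpV n (q n).1 (q n).2
  have hz : Tendsto (fun n => z₀ - (1 / 2 : ℝ) ^ n • (q n).1) atTop (𝓝 z₀) := by
    have := tendsto_const_nhds (x := z₀).sub
      ((tendsto_pow_atTop_nhds_zero_of_lt_one (r := (1 / 2 : ℝ)) (by norm_num)
        (by norm_num)).smul hq0)
    simpa using this
  refine ⟨(a, z₀), hWc.mem_of_tendsto (ha.prodMk_nhds hz) (Eventually.of_forall fun n => ?_), rfl⟩
  simpa using hsW n 0 h0

/-- The Robinson–Ursescu theorem: an algebraically interior point of the range of a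
multifunction with closed convex graph is an interior point of the range. -/
theorem Convex.snd_image_mem_nhds {Y Z : Type*} [AddCommGroup Y] [Module ℝ Y]
    [UniformSpace Y] [IsUniformAddGroup Y] [ContinuousSMul ℝ Y] [LocallyConvexSpace ℝ Y]
    [FirstCountableTopology Y] [CompleteSpace Y]
    [AddCommGroup Z] [Module ℝ Z] [TopologicalSpace Z] [IsTopologicalAddGroup Z]
    [ContinuousSMul ℝ Z] [FirstCountableTopology Z] [BaireSpace Z]
    {W : Set (Y × Z)} (hW : Convex ℝ W) (hWc : IsClosed W) {z₀ : Z}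
    (habs : ∀ z : Z, ∃ t : ℝ, 0 < t ∧ z₀ + t • z ∈ Prod.snd '' W) :
    Prod.snd '' W ∈ 𝓝 z₀ := by
  obtain ⟨y₀, hy₀⟩ : ∃ y₀, (y₀, z₀) ∈ W := by
    obtain ⟨t, -, ⟨y, z⟩, hyz, h⟩ := habs 0
    exact ⟨y, by simpa [show z = z₀ by simpa using h] using hyz⟩
  have hmem (z : Z) : z ∈ Prod.snd '' ((fun p => (y₀, z₀) + p) ⁻¹' W) ↔
      z₀ + z ∈ Prod.snd '' W := by
    constructor
    · rintro ⟨p, hp, rfl⟩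
      exact ⟨_, hp, rfl⟩
    · rintro ⟨p, hp, h⟩
      exact ⟨p - (y₀, z₀), by simpa using hp, by simp [h]⟩
  have := Convex.snd_image_mem_nhds_zero_of_zero_mem (hW.translate_preimage_right (y₀, z₀))
    (hWc.preimage (continuous_const.add continuous_id)) (by simpa using hy₀)
    (fun z => by simpa only [hmem] using habs z)
  have h2 : (fun z => z - z₀) ⁻¹' (Prod.snd '' ((fun p => (y₀, z₀) + p) ⁻¹' W)) ∈ 𝓝 z₀ :=
    (continuous_id.sub continuous_const).continuousAt.preimage_mem_nhds (by simpa using this)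
  filter_upwards [h2] with z hz
  simpa using (hmem _).1 hz

theorem Convex.eq_univ_of_dense {E : Type*} [AddCommGroup E] [Module ℝ E] [TopologicalSpace E]
    [IsTopologicalAddGroup E] [ContinuousSMul ℝ E] {K : Set E} (hK : Convex ℝ K)
    (hd : closure K = univ) (hi : (interior K).Nonempty) : K = univ := by
  have := hK.interior_closure_eq_interior_of_nonempty_interior hi
  rw [hd, interior_univ] at this
  exact eq_univ_of_univ_subset (this.trans_subset interior_subset)

namespace LagrangeQri

/-! ### Conic hulls and generalized interiors at the origin. -/

section Cones

variable {E : Type*} [AddCommGroup E] [Module ℝ E]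

theorem mem_conicHull {U : Set E} {x : E} :
    x ∈ conicHull U ↔ ∃ t : ℝ, 0 ≤ t ∧ ∃ u ∈ U, t • u = x := by
  simp [conicHull, mem_smul_set]

theorem conicHull_mono {U V : Set E} (h : U ⊆ V) : conicHull U ⊆ conicHull V := by
  intro x hx
  obtain ⟨t, ht, u, hu, rfl⟩ := mem_conicHull.1 hx
  exact mem_conicHull.2 ⟨t, ht, u, h hu, rfl⟩

theorem subset_conicHull (U : Set E) : U ⊆ conicHull U := fun u hu =>
  mem_conicHull.2 ⟨1, zero_le_one, u, hu, one_smul _ _⟩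

theorem zero_mem_core {U : Set E} : (0 : E) ∈ core U ↔ 0 ∈ U ∧ conicHull U = univ := by
  simp [core]

theorem conicHull_subset_submodule {U : Set E} {L : Submodule ℝ E} (h : U ⊆ L) :
    conicHull U ⊆ L := by
  intro x hx
  obtain ⟨t, -, u, hu, rfl⟩ := mem_conicHull.1 hx
  exact L.smul_mem t (h hu)

theorem convex_conicHull {U : Set E} (hU : Convex ℝ U) : Convex ℝ (conicHull U) := by
  intro x hx y hy a b ha hb hab
  obtain ⟨s, hs, u, hu, rfl⟩ := mem_conicHull.1 hx
  obtain ⟨t, ht, w, hw, rfl⟩ := mem_conicHull.1 hy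
  rcases (add_nonneg (mul_nonneg ha hs) (mul_nonneg hb ht)).eq_or_lt with h | h
  · have h1 : a * s = 0 := by nlinarith [mul_nonneg ha hs, mul_nonneg hb ht]
    have h2 : b * t = 0 := by nlinarith [mul_nonneg ha hs, mul_nonneg hb ht]
    exact mem_conicHull.2 ⟨0, le_rfl, u, hu, by simp [smul_smul, h1, h2]⟩
  · refine mem_conicHull.2 ⟨_, h.le, _, hU hu hw (a := a * s / (a * s + b * t))
      (b := b * t / (a * s + b * t)) (by positivity) (by positivity) (by field_simp), ?_⟩
    rw [smul_add, smul_smul, smul_smul, smul_smul, smul_smul, mul_div_cancel₀ _ h.ne',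
      mul_div_cancel₀ _ h.ne']

theorem exists_pos_smul_mem_of_zero_mem_core {U : Set E} (h : (0 : E) ∈ core U) (z : E) :
    ∃ t : ℝ, 0 < t ∧ t • z ∈ U := by
  obtain ⟨h0, hU⟩ := zero_mem_core.1 h
  obtain ⟨t, ht, u, hu, rfl⟩ := mem_conicHull.1 (hU ▸ mem_univ z)
  rcases ht.eq_or_lt with rfl | ht
  · exact ⟨1, one_pos, by simpa using h0⟩
  · exact ⟨t⁻¹, inv_pos.2 ht, by simpa [smul_smul, inv_mul_cancel₀ ht.ne'] using hu⟩

variable [TopologicalSpace E]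

theorem zero_mem_qi {U : Set E} : (0 : E) ∈ qi U ↔ 0 ∈ U ∧ closure (conicHull U) = univ := by
  simp [qi]

theorem zero_mem_qri {U : Set E} :
    (0 : E) ∈ qri U ↔ 0 ∈ U ∧ ∃ L : Submodule ℝ E, closure (conicHull U) = (L : Set E) := by
  simp [qri]

theorem zero_mem_core_of_zero_mem_interior [ContinuousSMul ℝ E] {U : Set E}
    (h : (0 : E) ∈ interior U) : (0 : E) ∈ core U := by
  refine zero_mem_core.2 ⟨interior_subset h, eq_univ_of_forall fun z => ?_⟩
  have hlim : Tendsto (fun s : ℝ => s • z) (𝓝[>] 0) (𝓝 0) := by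
    have : Tendsto (fun s : ℝ => s • z) (𝓝 0) (𝓝 ((0 : ℝ) • z)) :=
      tendsto_id.smul tendsto_const_nhds
    rw [zero_smul] at this
    exact this.mono_left nhdsWithin_le_nhds
  obtain ⟨s, hsU, hs0⟩ := ((hlim.eventually (mem_interior_iff_mem_nhds.1 h)).and
    self_mem_nhdsWithin).exists
  have hs0 : 0 < s := hs0
  exact mem_conicHull.2 ⟨s⁻¹, (inv_pos.2 hs0).le, _, hsU, by
    rw [smul_smul, inv_mul_cancel₀ hs0.ne', one_smul]⟩

theorem zero_mem_qi_of_zero_mem_core {U : Set E} (h : (0 : E) ∈ core U) : (0 : E) ∈ qi U := by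
  obtain ⟨h0, hU⟩ := zero_mem_core.1 h
  exact zero_mem_qi.2 ⟨h0, by rw [hU, closure_univ]⟩

/-- For the converse, a closed subspace containing `U` contains `U - U`, hence the closed cone of `U
- U`, which is the whole space. -/
theorem zero_mem_qi_iff {U : Set E} :
    (0 : E) ∈ qi U ↔ (0 : E) ∈ qi (U - U) ∧ (0 : E) ∈ qri U := by
  constructor
  · intro h
    obtain ⟨h0, hU⟩ := zero_mem_qi.1 h
    refine ⟨zero_mem_qi.2 ⟨⟨0, h0, 0, h0, sub_zero 0⟩, ?_⟩,
      zero_mem_qri.2 ⟨h0, ⊤, by rw [hU, Submodule.top_coe]⟩⟩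
    have hsub : U ⊆ U - U := fun u hu => ⟨u, hu, 0, h0, sub_zero u⟩
    exact eq_univ_of_univ_subset (hU ▸ closure_mono (conicHull_mono hsub))
  · rintro ⟨h1, h2⟩
    obtain ⟨-, hU⟩ := zero_mem_qi.1 h1
    obtain ⟨h0, L, hL⟩ := zero_mem_qri.1 h2
    refine zero_mem_qi.2 ⟨h0, eq_univ_of_univ_subset ?_⟩
    have hUL : U ⊆ L := hL ▸ (subset_conicHull U).trans subset_closure
    have hdiff : U - U ⊆ L := by
      rintro _ ⟨a, ha, b, hb, rfl⟩
      exact L.sub_mem (hUL ha) (hUL hb)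
    have hcl : IsClosed (L : Set E) := hL ▸ isClosed_closure
    rw [hL, ← hU]
    exact closure_minimal (conicHull_subset_submodule hdiff) hcl

end Cones

/-! ### The closed convex graph behind `conicExtension` and `constraintRange`. -/

section Graph

variable {X Z : Type*} [AddCommGroup Z] [Module ℝ Z]

/-- The triples `(x, z, r)` with `x ∈ S`, `f x ≤ r + v` and `g x ≤ z`. -/
def lagrangeGraph (C : PointedCone ℝ Z) (S : Set X) (f : X → EReal) (g : X → WithTop Z) (v : ℝ) :
    Set (X × (Z × ℝ)) :=
  {p | p.1 ∈ S ∧ f p.1 ≤ ((p.2.2 + v : ℝ) : EReal) ∧ (p.1, p.2.1) ∈ epiC C g}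

theorem mem_epiC {C : PointedCone ℝ Z} {g : X → WithTop Z} {x : X} {z : Z} :
    (x, z) ∈ epiC C g ↔ ∃ y : Z, g x = y ∧ z - y ∈ C := by
  simp only [epiC, LeC, mem_ofPred_eq, WithTop.coe_ne_top, false_or]
  constructor
  · rintro ⟨y, z', hy, hz, h⟩
    exact ⟨y, hy, by rwa [WithTop.coe_injective hz]⟩
  · rintro ⟨y, hy, h⟩
    exact ⟨y, z, hy, rfl, h⟩

theorem exists_coe_of_mem_dom {f : X → EReal} (hf : ∀ x, ⊥ < f x) {x : X} (hx : x ∈ dom f) :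
    ∃ a : ℝ, f x = a :=
  ⟨(f x).toReal, (EReal.coe_toReal hx.ne (hf x).ne').symm⟩

theorem mem_conicExtension {C : PointedCone ℝ Z} {S : Set X} {f : X → EReal} {g : X → WithTop Z}
    {v : ℝ} (hf : ∀ x, ⊥ < f x) {p : Z × ℝ} :
    p ∈ conicExtension C S f g v ↔ ∃ x, (x, p) ∈ lagrangeGraph C S f g v := by
  constructor
  · rintro ⟨x, ⟨⟨hxf, hxS⟩, -⟩, y, hy, z, hz, ε, hε, h1, h2⟩
    obtain ⟨a, ha⟩ := exists_coe_of_mem_dom hf hxf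
    refine ⟨x, hxS, ?_, mem_epiC.2 ⟨y, hy, by simpa [h1] using hz⟩⟩
    rw [ha] at h2 ⊢
    norm_cast at h2 ⊢
    linarith
  · rintro ⟨x, hxS, hxf, hx⟩
    obtain ⟨y, hy, hyz⟩ := mem_epiC.1 hx
    have hd : x ∈ dom f := hxf.trans_lt (EReal.coe_lt_top _)
    obtain ⟨a, ha⟩ := exists_coe_of_mem_dom hf hd
    rw [ha] at hxf
    norm_cast at hxf
    refine ⟨x, ⟨⟨hd, hxS⟩, y, hy⟩, y, hy, p.1 - y, hyz, p.2 - (a - v), by linarith, by simp, ?_⟩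
    rw [ha]
    norm_cast
    ring

theorem conicExtension_eq_image {C : PointedCone ℝ Z} {S : Set X} {f : X → EReal}
    {g : X → WithTop Z} {v : ℝ} (hbot : ∀ x, ⊥ < f x) :
    conicExtension C S f g v = Prod.snd '' lagrangeGraph C S f g v := by
  ext p
  rw [mem_conicExtension hbot]
  simp

theorem mem_constraintRange {C : PointedCone ℝ Z} {S : Set X} {f : X → EReal}
    {g : X → WithTop Z} {z : Z} :
    z ∈ constraintRange C S f g ↔ ∃ x ∈ dom f ∩ S, (x, z) ∈ epiC C g := by
  simp only [mem_epiC]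
  constructor
  · rintro ⟨y, ⟨x, ⟨hx, -⟩, hy⟩, c, hc, rfl⟩
    exact ⟨x, hx, y, hy, by simpa using hc⟩
  · rintro ⟨x, hx, y, hy, h⟩
    exact ⟨y, ⟨x, ⟨hx, y, hy⟩, hy⟩, z - y, h, by simp⟩

theorem mem_constraintRange_iff_conicExtension {C : PointedCone ℝ Z} {S : Set X} {f : X → EReal}
    {g : X → WithTop Z} {v : ℝ} (hf : ∀ x, ⊥ < f x) {z : Z} :
    z ∈ constraintRange C S f g ↔ ∃ r : ℝ, (z, r) ∈ conicExtension C S f g v := by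
  rw [mem_constraintRange]
  simp only [mem_conicExtension hf]
  constructor
  · rintro ⟨x, ⟨hxf, hxS⟩, hx⟩
    obtain ⟨a, ha⟩ := exists_coe_of_mem_dom hf hxf
    exact ⟨a - v, x, hxS, by simp [ha], hx⟩
  · rintro ⟨r, x, hxS, hxf, hx⟩
    exact ⟨x, ⟨hxf.trans_lt (EReal.coe_lt_top _), hxS⟩, hx⟩

theorem conicExtension_mono_right {C : PointedCone ℝ Z} {S : Set X} {f : X → EReal}
    {g : X → WithTop Z} {v : ℝ} (hf : ∀ x, ⊥ < f x) {z : Z} {r r' : ℝ} (hr : r ≤ r')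
    (h : (z, r) ∈ conicExtension C S f g v) : (z, r') ∈ conicExtension C S f g v := by
  obtain ⟨x, hxS, hxf, hx⟩ := (mem_conicExtension hf).1 h
  exact (mem_conicExtension hf).2 ⟨x, hxS, hxf.trans (by norm_cast; simpa using hr), hx⟩

/-- Optimality of `v` enters here: a point above `z = 0` comes from a feasible `x`. -/
theorem nonneg_of_zero_mem_conicExtension {C : PointedCone ℝ Z} {S : Set X} {f : X → EReal}
    {g : X → WithTop Z} {v : ℝ} (hf : ∀ x, ⊥ < f x) (hv : primalValue C S f g = v) {r : ℝ}
    (h : ((0 : Z), r) ∈ conicExtension C S f g v) : 0 ≤ r := by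
  obtain ⟨x, hxS, hxf, hx⟩ := (mem_conicExtension hf).1 h
  obtain ⟨y, hy, hyC⟩ := mem_epiC.1 hx
  have hfeas : x ∈ feasible C S g := ⟨hxS, y, by simpa using hyC, hy⟩
  have : (v : EReal) ≤ ((r + v : ℝ) : EReal) := hv ▸ (biInf_le f hfeas).trans hxf
  norm_cast at this
  linarith

theorem isClosed_lagrangeGraph [TopologicalSpace X] [TopologicalSpace Z] {C : PointedCone ℝ Z}
    {S : Set X} {f : X → EReal} {g : X → WithTop Z} (v : ℝ) (hS : IsClosed S)
    (hf : LowerSemicontinuous f) (hg : IsCEpiClosed C g) :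
    IsClosed (lagrangeGraph C S f g v) := by
  refine (hS.preimage continuous_fst).inter (IsClosed.inter ?_ ?_)
  · exact hf.isClosed_epigraph.preimage (continuous_fst.prodMk
      (continuous_coe_real_ereal.comp (continuous_snd.snd.add continuous_const)))
  · exact hg.preimage (continuous_fst.prodMk continuous_snd.fst)

variable [AddCommGroup X] [Module ℝ X]

theorem IsConvex.le_coe {f : X → EReal} (hf : IsConvex f) (hbot : ∀ x, ⊥ < f x) {x y : X}
    {r s : ℝ} (hx : f x ≤ r) (hy : f y ≤ s) {a b : ℝ} (ha : 0 ≤ a) (hb : 0 ≤ b)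
    (hab : a + b = 1) : f (a • x + b • y) ≤ ((a * r + b * s : ℝ) : EReal) := by
  obtain ⟨p, hp⟩ := exists_coe_of_mem_dom hbot (hx.trans_lt (EReal.coe_lt_top r))
  obtain ⟨q, hq⟩ := exists_coe_of_mem_dom hbot (hy.trans_lt (EReal.coe_lt_top s))
  obtain rfl : b = 1 - a := by linarith
  have h := hf x y a ⟨ha, by linarith⟩
  rw [hp] at hx
  rw [hq] at hy
  norm_cast at hx hy
  simp only [hp, hq, convMul, EReal.coe_ne_top, if_false, convAdd, ← EReal.coe_mul,
    or_self, ← EReal.coe_add] at h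
  exact h.trans (EReal.coe_le_coe_iff.2 (add_le_add (mul_le_mul_of_nonneg_left hx ha)
    (mul_le_mul_of_nonneg_left hy hb)))

theorem IsCConvex.convex_epiC {C : PointedCone ℝ Z} {g : X → WithTop Z} (hg : IsCConvex C g) :
    Convex ℝ (epiC C g) := by
  rintro ⟨x, z⟩ hx ⟨x', z'⟩ hx' a b ha hb hab
  obtain ⟨y, hy, hyz⟩ := mem_epiC.1 hx
  obtain ⟨y', hy', hyz'⟩ := mem_epiC.1 hx'
  obtain rfl : b = 1 - a := by linarith
  have h := hg x x' a ⟨ha, by linarith⟩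
  rw [hy, hy'] at h
  have h' : (a • x + (1 - a) • x', a • y + (1 - a) • y') ∈ epiC C g := h
  obtain ⟨w, hw, hwC⟩ := mem_epiC.1 h'
  refine mem_epiC.2 ⟨w, hw, ?_⟩
  have := C.add_mem hwC (C.add_mem (C.smul_mem ha hyz) (C.smul_mem hb hyz'))
  convert this using 1
  simp only [Prod.smul_snd]
  module

theorem convex_lagrangeGraph {C : PointedCone ℝ Z} {S : Set X} {f : X → EReal}
    {g : X → WithTop Z} (v : ℝ) (hS : Convex ℝ S) (hf : IsConvex f) (hbot : ∀ x, ⊥ < f x)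
    (hg : IsCConvex C g) : Convex ℝ (lagrangeGraph C S f g v) := by
  rintro ⟨x, z, r⟩ ⟨hxS, hxf, hxg⟩ ⟨x', z', r'⟩ ⟨hxS', hxf', hxg'⟩ a b ha hb hab
  refine ⟨hS hxS hxS' ha hb hab, (hf.le_coe hbot hxf hxf' ha hb hab).trans ?_,
    hg.convex_epiC hxg hxg' ha hb hab⟩
  refine EReal.coe_le_coe_iff.2 (le_of_eq ?_)
  obtain rfl : b = 1 - a := by linarith
  simp only [Prod.snd_add, Prod.smul_snd, smul_eq_mul]
  ring

end Graph

/-! ### From core to interior, and exclusion from the qri. -/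

section Interior

variable {X Z : Type*} [AddCommGroup X] [Module ℝ X] [AddCommGroup Z] [Module ℝ Z]
  {C : PointedCone ℝ Z} {S : Set X} {f : X → EReal} {g : X → WithTop Z} {v : ℝ}

theorem convex_conicExtension (hS : Convex ℝ S) (hf : IsConvex f) (hbot : ∀ x, ⊥ < f x)
    (hg : IsCConvex C g) : Convex ℝ (conicExtension C S f g v) := by
  rw [conicExtension_eq_image hbot]
  exact (convex_lagrangeGraph v hS hf hbot hg).linear_image (LinearMap.snd ℝ X (Z × ℝ))

/-- A point of `conicExtension` above `t • z` has uncontrolled height `r`. A short enough step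
towards it from `(0, r₀)` costs at most the extra height `1`, and heights may always be increased.
-/
theorem exists_pos_add_smul_mem_conicExtension (hS : Convex ℝ S) (hf : IsConvex f)
    (hbot : ∀ x, ⊥ < f x) (hg : IsCConvex C g) (hcore : 0 ∈ core (constraintRange C S f g))
    {r₀ : ℝ} (h₀ : ((0 : Z), r₀) ∈ conicExtension C S f g v) (p : Z × ℝ) :
    ∃ t : ℝ, 0 < t ∧ ((0 : Z), r₀ + 1) + t • p ∈ conicExtension C S f g v := by
  obtain ⟨z, s⟩ := p
  obtain ⟨t, ht, htz⟩ := exists_pos_smul_mem_of_zero_mem_core hcore z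
  obtain ⟨r, hr⟩ := (mem_constraintRange_iff_conicExtension (v := v) hbot).1 htz
  -- Chosen so that `K⁻¹ ≤ 1` and the excess height, scaled by `K⁻¹`, is at most `1`.
  set K := |r - r₀ - t * s| + 1
  have hK : 1 ≤ K := le_add_of_nonneg_left (abs_nonneg _)
  have hθ : K⁻¹ ≤ 1 := inv_le_one_of_one_le₀ hK
  have hKpos : 0 < K := by positivity
  refine ⟨K⁻¹ * t, by positivity, ?_⟩
  have hmem := convex_conicExtension hS hf hbot hg h₀ hr (sub_nonneg.2 hθ)
    (inv_nonneg.2 hKpos.le) (by ring)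
  have hbound : K⁻¹ * (r - r₀ - t * s) ≤ 1 := by
    rw [inv_mul_le_iff₀ hKpos, mul_one]
    exact (le_abs_self _).trans (le_add_of_nonneg_right zero_le_one)
  have hle : (1 - K⁻¹) * r₀ + K⁻¹ * r ≤ r₀ + 1 + K⁻¹ * t * s := by linarith
  have := conicExtension_mono_right hbot hle (by simpa [smul_smul] using hmem)
  simpa using this

variable [UniformSpace X] [FrechetSpace X] [UniformSpace Z] [FrechetSpace Z]

theorem conicExtension_mem_nhds (hS : Convex ℝ S) (hSc : IsClosed S) (hf : IsConvex f)
    (hbot : ∀ x, ⊥ < f x) (hfl : LowerSemicontinuous f) (hg : IsCConvex C g)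
    (hgc : IsCEpiClosed C g) (hcore : 0 ∈ core (constraintRange C S f g)) {r₀ : ℝ}
    (h₀ : ((0 : Z), r₀) ∈ conicExtension C S f g v) :
    conicExtension C S f g v ∈ 𝓝 ((0 : Z), r₀ + 1) := by
  -- With completeness, this gives the Baire property of `Z × ℝ`.
  have : (uniformity Z).IsCountablyGenerated :=
    IsUniformAddGroup.uniformity_countably_generated
  have habs := exists_pos_add_smul_mem_conicExtension hS hf hbot hg hcore h₀
  rw [conicExtension_eq_image hbot] at habs ⊢
  exact (convex_lagrangeGraph v hS hf hbot hg).snd_image_mem_nhds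
    (isClosed_lagrangeGraph v hSc hfl hgc) habs

theorem zero_mem_interior_constraintRange (hS : Convex ℝ S) (hSc : IsClosed S)
    (hf : IsConvex f) (hbot : ∀ x, ⊥ < f x) (hfl : LowerSemicontinuous f)
    (hg : IsCConvex C g) (hgc : IsCEpiClosed C g)
    (hcore : 0 ∈ core (constraintRange C S f g)) :
    0 ∈ interior (constraintRange C S f g) := by
  -- `constraintRange` does not depend on `v`, so any value serves.
  obtain ⟨r₀, h₀⟩ := (mem_constraintRange_iff_conicExtension (v := 0) hbot).1 hcore.1
  have h := conicExtension_mem_nhds hS hSc hf hbot hfl hg hgc hcore h₀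
  rw [mem_interior_iff_mem_nhds]
  have h' : (fun z : Z => (z, r₀ + 1)) ⁻¹' conicExtension C S f g 0 ∈ 𝓝 0 :=
    (continuous_id.prodMk continuous_const).continuousAt.preimage_mem_nhds h
  filter_upwards [h'] with z hz
  exact (mem_constraintRange_iff_conicExtension hbot).2 ⟨_, hz⟩

theorem zero_notMem_qri_convexHull_conicExtension (hS : Convex ℝ S) (hSc : IsClosed S)
    (hf : IsConvex f) (hbot : ∀ x, ⊥ < f x) (hfl : LowerSemicontinuous f)
    (hg : IsCConvex C g) (hgc : IsCEpiClosed C g)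
    (hcore : 0 ∈ core (constraintRange C S f g)) (hv : primalValue C S f g = v) :
    ((0, 0) : Z × ℝ) ∉ qri (convexHull ℝ (conicExtension C S f g v ∪ {(0, 0)})) := by
  intro hqri
  obtain ⟨r₀, h₀⟩ := (mem_constraintRange_iff_conicExtension (v := v) hbot).1 hcore.1
  have hE := convex_conicExtension (v := v) hS hf hbot hg
  have hnhds := conicExtension_mem_nhds hS hSc hf hbot hfl hg hgc hcore h₀
  obtain ⟨-, L, hL⟩ := zero_mem_qri.1 hqri
  set U := convexHull ℝ (conicExtension C S f g v ∪ {(0, 0)})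
  have hEU : conicExtension C S f g v ⊆ conicHull U :=
    (subset_union_left.trans (subset_convexHull ℝ _)).trans (subset_conicHull U)
  have hEL : conicExtension C S f g v ⊆ L := hL ▸ hEU.trans subset_closure
  have hLtop : L = ⊤ := by
    apply Submodule.eq_top_of_nonempty_interior'
    exact ⟨_, mem_interior_iff_mem_nhds.2 (mem_of_superset hnhds hEL)⟩
  have hint : (interior (conicHull U)).Nonempty :=
    ⟨_, mem_interior_iff_mem_nhds.2 (mem_of_superset hnhds hEU)⟩
  have hU := (convex_conicHull (convex_convexHull ℝ _)).eq_univ_of_dense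
    (by rw [hL, hLtop, Submodule.top_coe]) hint
  obtain ⟨t, ht, u, hu, htu⟩ := mem_conicHull.1 (hU ▸ mem_univ ((0 : Z), (-1 : ℝ)))
  -- The hull consists of segments from `(0, 0)` to the convex set `conicExtension`, so `(0, -1)` is
  -- a multiple `t * a` of some `(z, r)` in it; then `z = 0` and `r < 0`.
  rw [convexHull_union ⟨_, h₀⟩ (singleton_nonempty _), hE.convexHull_eq,
    convexHull_singleton] at hu
  obtain ⟨e, he, o, rfl, a, b, ha, hb, hab, rfl⟩ := mem_convexJoin.1 hu
  obtain ⟨z, r⟩ := e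
  simp only [Prod.smul_mk, smul_zero, Prod.mk_add_mk, add_zero, Prod.mk.injEq, smul_eq_mul,
    mul_zero] at htu
  have hpos : 0 < t * a := (mul_nonneg ht ha).lt_of_ne fun h => by
    have := htu.2
    rw [← mul_assoc, ← h] at this
    norm_num at this
  obtain rfl : z = 0 := by
    have := htu.1
    rw [smul_smul] at this
    exact (smul_eq_zero.1 this).resolve_left hpos.ne'
  have := mul_nonneg hpos.le (nonneg_of_zero_mem_conicExtension hbot hv he)
  linarith [htu.2]

end Interior

/-- The set `y + C`, with `y` the value of `g` at the Slater point, is already a neighbourhood of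
`0`. -/
theorem zero_mem_interior_constraintRange_of_slater {X Z : Type*} [AddCommGroup Z] [Module ℝ Z]
    [TopologicalSpace Z] [IsTopologicalAddGroup Z] {C : PointedCone ℝ Z} {S : Set X}
    {f : X → EReal} {g : X → WithTop Z} (h : RC1 C S f g) :
    0 ∈ interior (constraintRange C S f g) := by
  obtain ⟨x, hx, y, hy, hgx⟩ := h
  rw [mem_interior_iff_mem_nhds]
  have : (fun z => z - y) ⁻¹' (C : Set Z) ∈ 𝓝 0 := by
    apply (continuous_id.sub continuous_const).continuousAt.preimage_mem_nhds
    simpa using mem_interior_iff_mem_nhds.1 hy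
  filter_upwards [this] with z hz
  exact mem_constraintRange.2 ⟨x, hx, mem_epiC.2 ⟨y, hgx, hz⟩⟩

end LagrangeQri

theorem proposition6p4 {X Z : Type*}
    [AddCommGroup X] [Module ℝ X] [UniformSpace X] [FrechetSpace X]
    [AddCommGroup Z] [Module ℝ Z] [UniformSpace Z] [FrechetSpace Z]
    (C : PointedCone ℝ Z) (S : Set X) (f : X → EReal) (g : X → WithTop Z)
    (hS_nonempty : S.Nonempty) (hS_convex : Convex ℝ S) (hS_closed : IsClosed S)
    (hf_proper : IsProper f) (hf_convex : IsConvex f) (hf_lsc : LowerSemicontinuous f)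
    (hg_proper : (vdom g).Nonempty) (hg_convex : IsCConvex C g) (hg_closed : IsCEpiClosed C g)
    (h_feasible : (dom f ∩ S ∩ vpreimage g (-(C : Set Z))).Nonempty)
    (v : ℝ) (hv : primalValue C S f g = (v : EReal)) :
    (RC1 C S f g → RC2 C S f g) ∧
    (RC2 C S f g ↔ RC3 C S f g) ∧
    (RC3 C S f g → RC6 C S f g v) ∧
    (RC6 C S f g v ↔ RC7 C S f g v) := by
  have hbot := hf_proper.2
  refine ⟨fun h => ⟨‹_›, ‹_›, hS_closed, hf_lsc, hg_closed,
    zero_mem_interior_constraintRange_of_slater h⟩, ⟨?_, ?_⟩, ?_, ?_⟩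
  · rintro ⟨h1, h2, h3, h4, h5, h⟩
    exact ⟨h1, h2, h3, h4, h5, zero_mem_core_of_zero_mem_interior h⟩
  · rintro ⟨h1, h2, h3, h4, h5, h⟩
    exact ⟨h1, h2, h3, h4, h5, zero_mem_interior_constraintRange hS_convex hS_closed hf_convex
      hbot hf_lsc hg_convex hg_closed h⟩
  · rintro ⟨-, -, -, -, -, h⟩
    exact ⟨zero_mem_qi_of_zero_mem_core h, zero_notMem_qri_convexHull_conicExtension hS_convex
      hS_closed hf_convex hbot hf_lsc hg_convex hg_closed h hv⟩
  · rw [RC6, RC7, zero_mem_qi_iff, and_assoc]
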